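/- Let $K$ be a field (of arbitrary characteristic), and let $V$ be an algebraic variety over $K$ (a reduced separated scheme of finite type over $K$, not necessarily affine) with algebraic operations $+,\times\colon V\times_K V\to V$ making it an associative unitary ring (that is, $V$ is a ring object in the category of $K$-schemes). Write $V(K)$ for the ring of $K$-points of $V$ and $V^*=V(K)^\times$ for its group of units. Suppose that $V$ is irreducible. Then $V^*$ is linear over $K$: for some $n$ there is an injective group homomorphism $V^*\to \mathrm{GL}_n(K)$. Moreover, let $A$ be the local ring of $V$ at the point $\mathbf 0$ and $I$ its maximal ideal. For $v \in V^*$ let $l_v\colon V\to V$, $x\mapsto vx$, be the left multiplication by $v$; it fixes $\mathbf 0$. There is an integer $M>0$ such that $A/I^M$ is finite dimensional over $K$ and the rule sending the class of a germ $f$ to the class of $f\circ l_{v^{-1}}$ (that is, $(v\cdot f)(x)=f(v^{-1}x)$) is a well-defined faithful action of $V^*$ on $A/I^M$ by $K$-algebra automorphisms. -/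

import Mathlib

open CategoryTheory MonoidalCategory CartesianMonoidalCategory AlgebraicGeometry
open scoped MonObj AddMonObj RingObj

universe u

/-- A group `G` is linear over the field `K` if it embeds into `GL_n(K)` for some `n`. -/
def IsLinearGroup (K : Type*) [Field K] (G : Type*) [Group G] : Prop :=
  ∃ (n : ℕ) (ρ : G →* GL (Fin n) K), Function.Injective ρ

namespace RingVariety

variable {K : Type u} [Field K]

/-- An algebraic variety over `K`: a reduced separated scheme of finite type over `K`
(not necessarily irreducible, and not necessarily affine). -/
class IsAlgebraicVariety (V : Over (Spec (.of K))) : Prop where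
  isReduced : IsReduced V.left
  isSeparated : IsSeparated V.hom
  locallyOfFiniteType : LocallyOfFiniteType V.hom
  quasiCompact : QuasiCompact V.hom

/-- The `K`-points of `V`, i.e. the morphisms `Spec K ⟶ V` of `K`-schemes. When `V` is a ring
object (it carries algebraic operations making it an associative unitary ring), this is a ring,
with operations obtained by composition with those of `V`. -/
abbrev Points (V : Over (Spec (.of K))) : Type u := 𝟙_ (Over (Spec (.of K))) ⟶ V

/-- The point of the underlying space of `V` given by a `K`-point. -/
noncomputable def Points.pt {V : Over (Spec (.of K))} (x : Points V) : V.left :=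
  x.left (IsLocalRing.closedPoint K)

/-- The local ring of `V` at a `K`-point. -/
noncomputable abbrev localRing (V : Over (Spec (.of K))) (x : Points V) : CommRingCat.{u} :=
  V.left.presheaf.stalk x.pt

/-- The `K`-algebra structure of the local ring: constants are regular functions. -/
noncomputable instance (V : Over (Spec (.of K))) (x : Points V) : Algebra K (localRing V x) :=
  ((Scheme.ΓSpecIso (.of K)).inv ≫ V.hom.appTop ≫
    V.left.presheaf.germ ⊤ x.pt trivial).hom.toAlgebra

section

variable (V : Over (Spec (.of K))) [RingObj V]

/-- Left multiplication `l_v : V ⟶ V`, `x ↦ v * x`, by a `K`-point `v` of `V`: the product, in the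
ring of `V`-valued points of `V`, of the constant point `v` and the tautological point. -/
noncomputable def leftMul (v : Points V) : V ⟶ V := (toUnit V ≫ v) * 𝟙 V

lemma comp_leftMul (v x : Points V) : x ≫ leftMul V v = v * x := by
  have h : x ≫ toUnit V = 𝟙 _ := toUnit_unique _ _
  rw [leftMul, MonObj.comp_mul, ← Category.assoc, h]
  simp

/-- `l_v` maps the point `0` to itself. -/
lemma leftMul_pt_zero (v : Points V) :
    (leftMul V v).left (0 : Points V).pt = (0 : Points V).pt := by
  have h := comp_leftMul V v 0
  rw [mul_zero] at h
  conv_rhs => rw [← h]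
  rfl

lemma zero_mem_preimage (v : Points V) {U : V.left.Opens} (hU : (0 : Points V).pt ∈ U) :
    (0 : Points V).pt ∈ (leftMul V v).left ⁻¹ᵁ U := by
  change (leftMul V v).left (0 : Points V).pt ∈ U
  rwa [leftMul_pt_zero]

/-- The quotient `A / I ^ M` of the local ring `A` of `V` at `0` by a power of its maximal
ideal `I`. -/
abbrev Jets (M : ℕ) : Type u :=
  localRing V 0 ⧸ IsLocalRing.maximalIdeal (localRing V 0) ^ M

/-- The class in `A / I ^ M` of a regular function defined on a neighbourhood of `0`. -/
noncomputable def jet (M : ℕ) (U : V.left.Opens) (hU : (0 : Points V).pt ∈ U)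
    (f : Γ(V.left, U)) : Jets V M :=
  Ideal.Quotient.mk _ (V.left.presheaf.germ U (0 : Points V).pt hU f)

/-- `ψ` is the action of the units `v` of `V` on `A / I ^ M` by `f ↦ (x ↦ f (v⁻¹ * x))`. -/
def IsJetAction (M : ℕ) (ψ : (Points V)ˣ →* (Jets V M ≃ₐ[K] Jets V M)) : Prop :=
  ∀ (v : (Points V)ˣ) (U : V.left.Opens) (hU : (0 : Points V).pt ∈ U) (f : Γ(V.left, U)),
    ψ v (jet V M U hU f) =
      jet V M ((leftMul V (↑v⁻¹ : Points V)).left ⁻¹ᵁ U) (zero_mem_preimage V _ hU)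
        ((leftMul V (↑v⁻¹ : Points V)).left.app U f)

end

end RingVariety

/-!
Let `A` be the local ring of `V` at `0` and `I` its maximal ideal. For a `K`-point `v` of `V`, left
multiplication `l_v` fixes `0`, hence induces a `K`-algebra endomorphism `λ_v : f ↦ f ∘ l_v` of `A`
and of each `A / I ^ M`, and `λ_{vw} = λ_w ∘ λ_v`; so `v ↦ λ_{v⁻¹}` is an action of the units. The
algebra `A / I ^ M` is finite over `K`, since `A` is Noetherian with residue field `K`.

The action on `A` itself is faithful (`eq_one_of_leftMulStalk_eq_id`): if `λ_v = id`, then `l_v`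
and the identity agree after composition with `Spec A ⟶ V`, which is dominant because `V` is
irreducible; as `V` is reduced and separated, `l_v` is the identity, and `v = v * 1 = 1`.

A single `M` suffices for all `v` (`exists_forall_leftMulStalk_eq_id`). The sets
`C_M = {v | λ_v = id on A / I ^ M}` decrease with `M`, and they are closed in `V(K)` for the topology
induced by the Noetherian space `V`, so they stabilise; by Krull's intersection theorem their
intersection is `{v | λ_v = id on A}`.

To see that `C_M` is closed (`isClosed_setOf_comp_leftMul_eq`), put `B = A / I ^ M` and let
`i : Spec B ⟶ V` be the inclusion, so that `v ∈ C_M` means `i ≫ l_v = i`. For an affine open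
`Spec R ⊆ V`, the product of the two tautological points of `V` with values in `R ⊗ B` is compared
with the pullback of `i`. As `V` is separated, the two agree on the closed subscheme cut out by
some ideal `J` of `R ⊗ B`. A basis of `B` over `K` is a basis of `R ⊗ B` over `R`, and a `K`-point
of `Spec R` lies in `C_M` exactly when all the coordinates of the elements of `J` vanish there.
-/

/-! ### The action of an endomorphism on the stalk at a fixed point -/

namespace AlgebraicGeometry.Scheme

variable {X : Scheme.{u}} {x : X}

/-- The endomorphism `f ↦ f ∘ g` of the stalk at a fixed point `x` of an endomorphism `g` of a
scheme. Since `g x = x` is only a propositional equality, `stalkMap` is precomposed with the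
identification of the stalks at `x` and `g x`. -/
noncomputable def stalkEnd (g : X ⟶ X) (h : g x = x) : X.presheaf.stalk x ⟶ X.presheaf.stalk x :=
  X.presheaf.stalkSpecializes (specializes_of_eq h) ≫ g.stalkMap x

lemma germ_stalkEnd (f : X ⟶ X) (h : f x = x) (U : X.Opens) (hU : x ∈ U) (hU' : x ∈ f ⁻¹ᵁ U) :
    X.presheaf.germ U x hU ≫ stalkEnd f h = f.app U ≫ X.presheaf.germ (f ⁻¹ᵁ U) x hU' := by
  rw [stalkEnd, ← Category.assoc, TopCat.Presheaf.germ_stalkSpecializes, Scheme.Hom.germ_stalkMap]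

lemma specMap_stalkEnd_fromSpecStalk (f : X ⟶ X) (h : f x = x) :
    Spec.map (stalkEnd f h) ≫ X.fromSpecStalk x = X.fromSpecStalk x ≫ f := by
  rw [stalkEnd, Spec.map_comp, Category.assoc, SpecMap_stalkSpecializes_fromSpecStalk,
    SpecMap_stalkMap_fromSpecStalk]

lemma specMap_fromSpecStalk_cancel {R : CommRingCat.{u}} {f g : X.presheaf.stalk x ⟶ R}
    (h : Spec.map f ≫ X.fromSpecStalk x = Spec.map g ≫ X.fromSpecStalk x) : f = g :=
  Spec.map_injective (by rwa [cancel_mono] at h)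

lemma stalkEnd_comp (f g : X ⟶ X) (hf : f x = x) (hg : g x = x) (hfg : (f ≫ g) x = x) :
    stalkEnd (f ≫ g) hfg = stalkEnd g hg ≫ stalkEnd f hf := by
  apply specMap_fromSpecStalk_cancel
  rw [Spec.map_comp, Category.assoc, specMap_stalkEnd_fromSpecStalk,
    specMap_stalkEnd_fromSpecStalk, ← Category.assoc, ← Category.assoc,
    specMap_stalkEnd_fromSpecStalk]

lemma stalkEnd_id (h : (𝟙 X : X ⟶ X) x = x) : stalkEnd (𝟙 X) h = 𝟙 _ := by
  apply specMap_fromSpecStalk_cancel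
  rw [specMap_stalkEnd_fromSpecStalk]; simp

lemma isLocalHom_stalkEnd (f : X ⟶ X) (h : f x = x) : IsLocalHom (stalkEnd f h).hom := by
  have : X.presheaf.stalkSpecializes (specializes_of_eq h)
      = (X.presheaf.stalkCongr (.of_eq h.symm)).hom := rfl
  rw [stalkEnd, this]
  infer_instance

/-- The generic point of an irreducible scheme is a generization of every point, hence lies in the
image of every `Spec 𝒪_{X, x}`. -/
lemma isDominant_fromSpecStalk [IrreducibleSpace X] : IsDominant (X.fromSpecStalk x) := by
  refine ⟨?_⟩
  rw [DenseRange, range_fromSpecStalk]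
  exact (dense_iff_closure_eq.2 (genericPoint_spec X).def).mono
    (Set.singleton_subset_iff.2 (genericPoint_specializes x))

end AlgebraicGeometry.Scheme

/-! ### Morphisms from affine schemes to a separated scheme -/

namespace RingVariety

open Limits

variable {K : Type u} [Field K]

/-- The spectrum of a `K`-algebra as a `K`-scheme. -/
noncomputable abbrev specOver (K : Type u) [Field K] (S : Type u) [CommRing S] [Algebra K S] :
    Over (Spec (.of K)) :=
  Over.mk (Spec.map (CommRingCat.ofHom (algebraMap K S)))

/-- The morphism of `K`-schemes given by a homomorphism of `K`-algebras. -/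
noncomputable def specOverMap {S T : Type u} [CommRing S] [Algebra K S] [CommRing T] [Algebra K T]
    (f : S →ₐ[K] T) : specOver K T ⟶ specOver K S :=
  Over.homMk (Spec.map (CommRingCat.ofHom f.toRingHom)) (by
    dsimp [specOver]
    rw [← Spec.map_comp, ← CommRingCat.ofHom_comp]
    congr 2
    exact f.comp_algebraMap)

/-- The equalizer of two morphisms from an affine scheme to a separated scheme is a closed
subscheme, so it is cut out by an ideal. -/
lemma exists_ideal_specOverMap_comp_eq_iff {V : Over (Spec (.of K))} [IsSeparated V.hom]
    {S : Type u} [CommRing S] [Algebra K S] (a b : specOver K S ⟶ V) :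
    ∃ J : Ideal S, ∀ (T : Type u) [CommRing T] [Algebra K T] (f : S →ₐ[K] T),
      specOverMap f ≫ a = specOverMap f ≫ b ↔ J ≤ RingHom.ker f := by
  let c : (equalizer a b).left ⟶ Spec (.of S) := (equalizer.ι a b).left
  have hc : IsClosedImmersion c := isClosedImmersion_equalizer_ι_left a b
  obtain ⟨J, e, he⟩ := IsClosedImmersion.Spec_iff.1 hc
  refine ⟨J, fun T _ _ f ↦ ⟨fun h ↦ ?_, fun h ↦ ?_⟩⟩
  · have h1 : (equalizer.lift _ h).left ≫ c = Spec.map (CommRingCat.ofHom f.toRingHom) :=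
      congr($(equalizer.lift_ι _ h).left)
    rw [he, ← Category.assoc] at h1
    obtain ⟨g, hg⟩ := Spec.map_surjective ((equalizer.lift _ h).left ≫ e.hom)
    rw [← hg, ← Spec.map_comp] at h1
    have h2 := Spec.map_injective h1
    intro s hs
    have h3 : g.hom (Ideal.Quotient.mk J s) = f s := congr($(h2).hom s)
    rw [RingHom.mem_ker, ← h3, Ideal.Quotient.eq_zero_iff_mem.2 hs, map_zero]
  · let g : S ⧸ J →+* T := Ideal.Quotient.lift J f.toRingHom fun s hs ↦ h hs
    have h1 : Spec.map (CommRingCat.ofHom f.toRingHom) =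
        Spec.map (CommRingCat.ofHom g) ≫ e.inv ≫ c := by
      rw [he, Iso.inv_hom_id_assoc, ← Spec.map_comp]
      rfl
    have h2 : c ≫ a.left = c ≫ b.left := congr($(equalizer.condition a b).left)
    ext1
    change Spec.map (CommRingCat.ofHom f.toRingHom) ≫ a.left =
      Spec.map (CommRingCat.ofHom f.toRingHom) ≫ b.left
    rw [h1]
    simp only [Category.assoc, h2]

/-- The condition that a `K`-point `φ` of `Spec R` satisfies `(φ ⊗ B)(J) = 0` is given by equations
in `R`: the coordinates of the elements of `J` with respect to the `R`-basis of `R ⊗ B` coming from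
a `K`-basis of `B`. -/
lemma exists_set_le_ker_lift_iff {R B : Type u} [CommRing R] [Algebra K R] [CommRing B]
    [Algebra K B] (J : Set (TensorProduct K R B)) :
    ∃ J' : Set R, ∀ φ : R →ₐ[K] K,
      (∀ s ∈ J, Algebra.TensorProduct.lift ((Algebra.ofId K B).comp φ) (AlgHom.id K B)
        (fun _ _ ↦ Commute.all _ _) s = 0) ↔ ∀ r ∈ J', φ r = 0 := by
  let b := Module.Free.chooseBasis K B
  let bR := Algebra.TensorProduct.basis R b
  refine ⟨{r | ∃ s ∈ J, ∃ i, bR.repr s i = r}, fun φ ↦ ?_⟩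
  have key (s) : Algebra.TensorProduct.lift ((Algebra.ofId K B).comp φ) (AlgHom.id K B)
      (fun _ _ ↦ Commute.all _ _) s = (bR.repr s).sum fun i r ↦ φ r • b i := by
    conv_lhs => rw [← bR.linearCombination_repr s, Finsupp.linearCombination_apply, Finsupp.sum,
      map_sum]
    refine Finset.sum_congr rfl fun i _ ↦ ?_
    rw [Algebra.TensorProduct.basis_apply, TensorProduct.smul_tmul', Algebra.TensorProduct.lift_tmul]
    simp [Algebra.smul_def, Algebra.ofId_apply]
  have key2 (s) : (bR.repr s).sum (fun i r ↦ φ r • b i) = 0 ↔ ∀ i, φ (bR.repr s i) = 0 := by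
    have : (bR.repr s).sum (fun i r ↦ φ r • b i)
        = Finsupp.linearCombination K b ((bR.repr s).mapRange φ (map_zero φ)) := by
      rw [Finsupp.linearCombination_apply, Finsupp.sum_mapRange_index]
      simp
    rw [this]
    constructor
    · intro h i
      have := (linearIndependent_iff.1 b.linearIndependent) _ h
      simpa using DFunLike.congr_fun this i
    · intro h
      have : (bR.repr s).mapRange φ (map_zero φ) = 0 := by ext i; simpa using h i
      rw [this, map_zero]
  constructor
  · rintro h _ ⟨s, hs, i, rfl⟩
    exact (key2 s).1 ((key s).symm.trans (h s hs)) i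
  · intro h s hs
    rw [key, key2]
    exact fun i ↦ h _ ⟨s, hs, i, rfl⟩

/-! ### `K`-points and their local rings -/

section Points

variable {V : Over (Spec (.of K))}

lemma specMap_algebraMap_localRing (x : Points V) :
    V.left.fromSpecStalk x.pt ≫ V.hom =
      Spec.map (CommRingCat.ofHom (algebraMap K (localRing V x))) := by
  have : CommRingCat.ofHom (algebraMap K (localRing V x)) =
    (Scheme.ΓSpecIso (.of K)).inv ≫ V.hom.appTop ≫ V.left.presheaf.germ ⊤ x.pt trivial := rfl
  rw [this, Spec.map_comp, Spec.map_comp, Category.assoc, ← Scheme.fromSpecStalk_toSpecΓ,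
    Category.assoc, ← Scheme.toSpecΓ_naturality_assoc, ← SpecMap_ΓSpecIso_hom, ← Spec.map_comp,
    Iso.inv_hom_id, Spec.map_id, Category.comp_id]

/-- Evaluation of germs at a `K`-point. -/
noncomputable def evalAt (x : Points V) : localRing V x →ₐ[K] K where
  __ := (Scheme.stalkClosedPointTo (R := .of K) x.left).hom
  commutes' := by
    have h1 := Scheme.Spec_stalkClosedPointTo_fromSpecStalk (R := .of K) x.left
    have h2 : x.left ≫ V.hom = 𝟙 _ := Over.w x
    rw [← h1, Category.assoc] at h2
    have h3 := specMap_algebraMap_localRing x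
    have h4 := (congr(Spec.map (Scheme.stalkClosedPointTo (R := .of K) x.left) ≫ $h3)).symm.trans h2
    replace h4 := (Spec.map_comp _ _).trans (h4.trans (Spec.map_id (.of K)).symm)
    exact fun r ↦ congr($(Spec.map_injective h4).hom r)

lemma evalAt_eq_zero (x : Points V) {f : localRing V x}
    (hf : f ∈ IsLocalRing.maximalIdeal (localRing V x)) : evalAt x f = 0 := by
  by_contra h
  refine hf (?_ : IsUnit f)
  have := Scheme.isLocalHom_stalkClosedPointTo' (R := K) x.left
  exact this.map_nonunit f (isUnit_iff_ne_zero.2 h)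

/-- The jet algebras are finite over `K`: their residue field is `K` because the centre is a
`K`-point, and their maximal ideal is nilpotent and finitely generated. -/
lemma finite_localRing_quotient (x : Points V) [IsNoetherianRing (localRing V x)] {M : ℕ}
    (hM : 0 < M) :
    Module.Finite K (localRing V x ⧸ IsLocalRing.maximalIdeal (localRing V x) ^ M) := by
  let I := IsLocalRing.maximalIdeal (localRing V x)
  have hI : ∀ f ∈ I ^ M, evalAt x f = 0 := fun f hf ↦ evalAt_eq_zero x (Ideal.pow_le_self hM.ne' hf)
  let g : (localRing V x ⧸ I ^ M) →ₐ[K] K := Ideal.Quotient.liftₐ (I ^ M) (evalAt x) hI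
  refine Module.finite_of_surjective_of_ker_le_nilradical g
    (fun r ↦ ⟨algebraMap K _ r, g.commutes r⟩) (fun y hy ↦ ?_) (IsNoetherian.noetherian _)
  obtain ⟨f, rfl⟩ := Ideal.Quotient.mk_surjective y
  refine ⟨M, ?_⟩
  rw [← map_pow]
  refine Ideal.Quotient.eq_zero_iff_mem.2 (Ideal.pow_mem_pow ?_ M)
  have h0 : evalAt x f = 0 := hy
  intro (hu : IsUnit f)
  exact (hu.map (evalAt x)).ne_zero h0

/-- A `K`-point of `V` lying in an affine open subscheme `Spec R` is a `K`-algebra homomorphism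
`R → K`, and it lies in the basic open set of `r` exactly when the value of `r` there is not `0`. -/
lemma exists_algHom_of_pt_mem {R : Type u} [CommRing R] [Algebra K R] (j : specOver K R ⟶ V)
    [IsOpenImmersion j.left] (v : Points V) (hv : v.pt ∈ Set.range j.left) :
    ∃ φ : R →ₐ[K] K, v.left = Spec.map (CommRingCat.ofHom φ.toRingHom) ≫ j.left ∧
      ∀ r, v.pt ∈ j.left '' (PrimeSpectrum.basicOpen r : Set (PrimeSpectrum R)) ↔ φ r ≠ 0 := by
  have hr : Set.range v.left ⊆ Set.range j.left := by
    rintro _ ⟨y, rfl⟩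
    have : y = IsLocalRing.closedPoint K := Subsingleton.elim (α := PrimeSpectrum K) _ _
    rw [this]
    exact hv
  obtain ⟨g, hg⟩ : ∃ g : CommRingCat.of R ⟶ CommRingCat.of K, v.left = Spec.map g ≫ j.left := by
    obtain ⟨g, hg⟩ := Spec.map_surjective (R := .of R) (S := .of K)
      (IsOpenImmersion.lift j.left v.left hr)
    exact ⟨g, by rw [hg]; exact (IsOpenImmersion.lift_fac j.left v.left hr).symm⟩
  have h1 : v.left ≫ V.hom = 𝟙 _ := Over.w v
  rw [hg, Category.assoc] at h1
  have h2 : j.left ≫ V.hom = Spec.map (CommRingCat.ofHom (algebraMap K R)) := Over.w j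
  have h3 := (congr(Spec.map g ≫ $h2)).symm.trans h1
  replace h3 := (Spec.map_comp _ _).trans (h3.trans (Spec.map_id (.of K)).symm)
  refine ⟨⟨g.hom, fun r ↦ congr($(Spec.map_injective h3).hom r)⟩, hg, fun r ↦ ?_⟩
  have h4 : v.pt = j.left (Spec.map g (IsLocalRing.closedPoint K)) := by
    rw [Points.pt, hg]; rfl
  rw [h4]
  refine (j.left.isOpenEmbedding.injective.mem_set_image).trans ?_
  change ¬ (g.hom r ∈ IsLocalRing.maximalIdeal K) ↔ ¬ (g.hom r = 0)
  rw [IsLocalRing.maximalIdeal_eq_bot, Ideal.mem_bot]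

variable (V) in
lemma isNoetherian_left [IsAlgebraicVariety V] : AlgebraicGeometry.IsNoetherian V.left := by
  have := IsAlgebraicVariety.locallyOfFiniteType (V := V)
  have := IsAlgebraicVariety.quasiCompact (V := V)
  have := LocallyOfFiniteType.isLocallyNoetherian V.hom
  have := QuasiCompact.compactSpace_of_compactSpace V.hom
  exact {}

end Points

/-! ### Left multiplications and closed conditions on `K`-points -/

section RingObject

variable (V : Over (Spec (.of K))) [RingObj V]

lemma comp_leftMul_eq_mul {T : Over (Spec (.of K))} (i : T ⟶ V) (v : Points V) :
    i ≫ leftMul V v = (toUnit T ≫ v) * i := by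
  rw [leftMul, MonObj.comp_mul, ← Category.assoc, toUnit_unique (i ≫ toUnit V) (toUnit T),
    Category.comp_id]

lemma leftMul_one : leftMul V 1 = 𝟙 V := by
  have := comp_leftMul_eq_mul V (𝟙 V) 1
  rw [Category.id_comp] at this
  rw [this, MonObj.comp_one, one_mul]

lemma leftMul_mul (v w : Points V) : leftMul V (v * w) = leftMul V w ≫ leftMul V v := by
  rw [comp_leftMul_eq_mul, leftMul, leftMul, MonObj.comp_mul, mul_assoc]

lemma leftMul_injective : Function.Injective (leftMul V) := fun v w h ↦ by
  rw [← mul_one v, ← mul_one w, ← comp_leftMul, ← comp_leftMul, h]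

/-- If `l_v` does not fix the `B`-valued point `i`, then neither does `l_w` for any `K`-point `w` in
a suitable basic open neighbourhood of `v`. -/
lemma exists_basicOpen_comp_leftMul_ne [IsSeparated V.hom] {B : Type u} [CommRing B] [Algebra K B]
    (i : specOver K B ⟶ V) {R : Type u} [CommRing R] [Algebra K R] (j : specOver K R ⟶ V)
    [IsOpenImmersion j.left] (v : Points V) (hv : v.pt ∈ Set.range j.left)
    (hne : i ≫ leftMul V v ≠ i) :
    ∃ r : R, v.pt ∈ j.left '' (PrimeSpectrum.basicOpen r : Set (PrimeSpectrum R)) ∧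
      ∀ w : Points V, w.pt ∈ j.left '' (PrimeSpectrum.basicOpen r : Set (PrimeSpectrum R)) →
        i ≫ leftMul V w ≠ i := by
  -- `p ≫ j` is the universal point of `Spec R ⊆ V` and `q ≫ i` the point `i`, both with values in
  -- `R ⊗ B`: specialising along `φ : R → K` turns `(p ≫ j) * (q ≫ i)` into `i ≫ leftMul V w`.
  let p : specOver K (TensorProduct K R B) ⟶ specOver K R :=
    specOverMap Algebra.TensorProduct.includeLeft
  let q : specOver K (TensorProduct K R B) ⟶ specOver K B :=
    specOverMap Algebra.TensorProduct.includeRight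
  obtain ⟨J, hJ⟩ := exists_ideal_specOverMap_comp_eq_iff ((p ≫ j) * (q ≫ i)) (q ≫ i)
  obtain ⟨J', hJ'⟩ := exists_set_le_ker_lift_iff (K := K) (R := R) (B := B) (J : Set _)
  have key (w : Points V) (φ : R →ₐ[K] K)
      (hw : w.left = Spec.map (CommRingCat.ofHom φ.toRingHom) ≫ j.left) :
      i ≫ leftMul V w = i ↔ ∀ r ∈ J', φ r = 0 := by
    rw [← hJ' φ]
    refine Iff.trans ?_ (hJ B _)
    let t : specOver K B ⟶ specOver K (TensorProduct K R B) :=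
      specOverMap (Algebra.TensorProduct.lift ((Algebra.ofId K B).comp φ) (AlgHom.id K B)
        (fun _ _ ↦ Commute.all _ _))
    change _ ↔ t ≫ _ = t ≫ _
    have h1 : t ≫ q ≫ i = i := by
      have : t ≫ q = 𝟙 _ := by
        ext1
        change Spec.map _ ≫ Spec.map _ = 𝟙 (Spec (.of B))
        rw [← Spec.map_comp, ← Spec.map_id, ← CommRingCat.ofHom_comp]
        congr 1
        ext b
        simp
      rw [← Category.assoc, this, Category.id_comp]
    have h2 : t ≫ p ≫ j = toUnit _ ≫ w := by
      ext1
      change Spec.map _ ≫ Spec.map _ ≫ j.left = (toUnit (specOver K B)).left ≫ w.left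
      have : (toUnit (specOver K B)).left = Spec.map (CommRingCat.ofHom (algebraMap K B)) :=
        (Category.comp_id _).symm.trans (Over.w (toUnit (specOver K B)))
      rw [hw, this, ← Spec.map_comp_assoc, ← Spec.map_comp_assoc, ← CommRingCat.ofHom_comp,
        ← CommRingCat.ofHom_comp]
      congr 3
      ext r
      simp [Algebra.ofId_apply]
    rw [MonObj.comp_mul, h1, h2, comp_leftMul_eq_mul]
  obtain ⟨φ, hφ, hφ'⟩ := exists_algHom_of_pt_mem j v hv
  rw [Ne, key v φ hφ] at hne
  push Not at hne
  obtain ⟨r, hr, hr0⟩ := hne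
  refine ⟨r, (hφ' r).2 hr0, fun w hw ↦ ?_⟩
  obtain ⟨ψ, hψ, hψ'⟩ := exists_algHom_of_pt_mem j w (Set.image_subset_range _ _ hw)
  rw [Ne, key w ψ hψ]
  exact fun h ↦ (hψ' r).1 hw (h r hr)

/-- The Zariski topology on the set of `K`-points, induced by the underlying space of `V`. -/
noncomputable abbrev zariskiTopology (V : Over (Spec (.of K))) : TopologicalSpace (Points V) :=
  .induced Points.pt inferInstance

lemma isClosed_setOf_comp_leftMul_eq [IsSeparated V.hom] {B : Type u} [CommRing B] [Algebra K B]
    (i : specOver K B ⟶ V) :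
    @IsClosed _ (zariskiTopology V) {v : Points V | i ≫ leftMul V v = i} := by
  let _ := zariskiTopology V
  refine isOpen_compl_iff.1 (isOpen_iff_forall_mem_open.2 fun v hv ↦ ?_)
  obtain ⟨_, ⟨U, hU, rfl⟩, hvU, -⟩ := V.left.isBasis_affineOpens.exists_subset_of_mem_open
    (Set.mem_univ v.pt) isOpen_univ
  obtain ⟨f, hf⟩ := Spec.map_surjective (hU.fromSpec ≫ V.hom)
  let _ : Algebra K Γ(V.left, U) := f.hom.toAlgebra
  let j : specOver K Γ(V.left, U) ⟶ V := Over.homMk hU.fromSpec hf.symm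
  have hj : IsOpenImmersion j.left := hU.isOpenImmersion_fromSpec
  have hv' : v.pt ∈ Set.range j.left := hU.range_fromSpec.ge hvU
  obtain ⟨r, hr, hr'⟩ := exists_basicOpen_comp_leftMul_ne V i j v hv' hv
  have hO : IsOpen (j.left '' (PrimeSpectrum.basicOpen r : Set (PrimeSpectrum _))) :=
    j.left.isOpenEmbedding.isOpenMap _ (PrimeSpectrum.basicOpen r).isOpen
  exact ⟨_, hr', isOpen_induced hO, hr⟩

/-! ### The action on the local ring at `0` and on jets -/

section Jets

/-- The endomorphism `f ↦ f ∘ l_v` of the local ring at `0`. -/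
noncomputable def leftMulStalk (v : Points V) : localRing V 0 →ₐ[K] localRing V 0 where
  __ := (Scheme.stalkEnd (leftMul V v).left (leftMul_pt_zero V v)).hom
  commutes' := by
    have h1 := specMap_algebraMap_localRing (0 : Points V)
    have h2 : (leftMul V v).left ≫ V.hom = V.hom := Over.w (leftMul V v)
    have h3 := Scheme.specMap_stalkEnd_fromSpecStalk _ (leftMul_pt_zero V v)
    let a : .of K ⟶ V.left.presheaf.stalk (0 : Points V).pt :=
      CommRingCat.ofHom (algebraMap K (localRing V 0))
    replace h1 : V.left.fromSpecStalk (0 : Points V).pt ≫ V.hom = Spec.map a := h1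
    have h4 : Spec.map (a ≫ Scheme.stalkEnd _ (leftMul_pt_zero V v)) = Spec.map a := by
      rw [Spec.map_comp, ← h1, ← Category.assoc, h3, Category.assoc, h2]
    exact fun r ↦ congr($(Spec.map_injective h4).hom r)

lemma leftMulStalk_germ (v : Points V) (U : V.left.Opens) (hU : (0 : Points V).pt ∈ U)
    (f : Γ(V.left, U)) :
    leftMulStalk V v (V.left.presheaf.germ U _ hU f) =
      V.left.presheaf.germ ((leftMul V v).left ⁻¹ᵁ U) _ (zero_mem_preimage V v hU)
        ((leftMul V v).left.app U f) :=
  congr($(Scheme.germ_stalkEnd _ (leftMul_pt_zero V v) U hU (zero_mem_preimage V v hU)).hom f)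

lemma leftMulStalk_one : leftMulStalk V 1 = AlgHom.id K _ := by
  have h : (leftMul V 1).left = 𝟙 V.left := by rw [leftMul_one]; rfl
  have : ∀ (g : V.left ⟶ V.left) (hg : g (0 : Points V).pt = (0 : Points V).pt), g = 𝟙 V.left →
      Scheme.stalkEnd g hg = 𝟙 _ := by
    rintro _ hg rfl; exact Scheme.stalkEnd_id hg
  ext f
  exact congr($(this _ (leftMul_pt_zero V 1) h).hom f)

lemma leftMulStalk_mul (v w : Points V) :
    leftMulStalk V (v * w) = (leftMulStalk V w).comp (leftMulStalk V v) := by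
  have h : (leftMul V (v * w)).left = (leftMul V w).left ≫ (leftMul V v).left := by
    rw [leftMul_mul]; rfl
  have : ∀ (g : V.left ⟶ V.left) (hg : g (0 : Points V).pt = (0 : Points V).pt),
      g = (leftMul V w).left ≫ (leftMul V v).left → Scheme.stalkEnd g hg =
        Scheme.stalkEnd _ (leftMul_pt_zero V v) ≫ Scheme.stalkEnd _ (leftMul_pt_zero V w) := by
    rintro _ hg rfl; exact Scheme.stalkEnd_comp _ _ _ _ hg
  ext f
  exact congr($(this _ (leftMul_pt_zero V _) h).hom f)

lemma leftMulStalk_mem_pow (v : Points V) (M : ℕ) {f : localRing V 0}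
    (hf : f ∈ IsLocalRing.maximalIdeal (localRing V 0) ^ M) :
    leftMulStalk V v f ∈ IsLocalRing.maximalIdeal (localRing V 0) ^ M := by
  have := Scheme.isLocalHom_stalkEnd _ (leftMul_pt_zero V v)
  have h : (IsLocalRing.maximalIdeal (localRing V 0)).map (leftMulStalk V v).toRingHom ≤
      IsLocalRing.maximalIdeal (localRing V 0) :=
    ((IsLocalRing.local_hom_TFAE (Scheme.stalkEnd _ (leftMul_pt_zero V v)).hom).out 0 2).1 this
  refine Ideal.pow_right_mono h M ?_
  rw [← Ideal.map_pow]
  exact Ideal.mem_map_of_mem _ hf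

/-- The endomorphism `f ↦ f ∘ l_v` of `A / I ^ M`. -/
noncomputable def leftMulJets (M : ℕ) (v : Points V) : Jets V M →ₐ[K] Jets V M :=
  Ideal.quotientMapₐ _ (leftMulStalk V v) fun _ hf ↦ leftMulStalk_mem_pow V v M hf

lemma leftMulJets_mk (M : ℕ) (v : Points V) (f : localRing V 0) :
    leftMulJets V M v (Ideal.Quotient.mk _ f) = Ideal.Quotient.mk _ (leftMulStalk V v f) := rfl

lemma leftMulJets_one (M : ℕ) : leftMulJets V M 1 = AlgHom.id K _ := by
  ext y
  obtain ⟨f, rfl⟩ := Ideal.Quotient.mk_surjective y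
  rw [leftMulJets_mk, leftMulStalk_one]; rfl

lemma leftMulJets_mul (M : ℕ) (v w : Points V) :
    leftMulJets V M (v * w) = (leftMulJets V M w).comp (leftMulJets V M v) := by
  ext y
  obtain ⟨f, rfl⟩ := Ideal.Quotient.mk_surjective y
  rw [leftMulJets_mk, leftMulStalk_mul]; rfl

/-- The action of the units of `V` on `A / I ^ M`. Composition with `l_v` reverses products, whence
the inverse. -/
noncomputable def jetAction (M : ℕ) : (Points V)ˣ →* (Jets V M ≃ₐ[K] Jets V M) where
  toFun v := AlgEquiv.ofAlgHom (leftMulJets V M ↑v⁻¹) (leftMulJets V M v)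
    (by rw [← leftMulJets_mul, Units.mul_inv, leftMulJets_one])
    (by rw [← leftMulJets_mul, Units.inv_mul, leftMulJets_one])
  map_one' := by
    ext y
    change leftMulJets V M ↑(1⁻¹ : (Points V)ˣ) y = y
    rw [inv_one, Units.val_one, leftMulJets_one]; rfl
  map_mul' v w := by
    ext y
    change leftMulJets V M ↑(v * w)⁻¹ y = leftMulJets V M ↑v⁻¹ (leftMulJets V M ↑w⁻¹ y)
    rw [mul_inv_rev, Units.val_mul, leftMulJets_mul]; rfl

lemma isJetAction_jetAction (M : ℕ) : IsJetAction V M (jetAction V M) := fun v U hU f ↦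
  congr(Ideal.Quotient.mk _ $(leftMulStalk_germ V ↑v⁻¹ U hU f))

/-- The inclusion into `V` of the `M`-th infinitesimal neighbourhood `Spec (A / I ^ M)` of `0`. -/
noncomputable def jetInclusion (M : ℕ) : specOver K (Jets V M) ⟶ V :=
  Over.homMk (Spec.map (CommRingCat.ofHom (Ideal.Quotient.mk _)) ≫
      V.left.fromSpecStalk (0 : Points V).pt) (by
    rw [Category.assoc, specMap_algebraMap_localRing, ← Spec.map_comp]; rfl)

lemma jetInclusion_comp_leftMul_eq_iff (M : ℕ) (v : Points V) :
    jetInclusion V M ≫ leftMul V v = jetInclusion V M ↔ leftMulJets V M v = AlgHom.id K _ := by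
  have h3 := Scheme.specMap_stalkEnd_fromSpecStalk _ (leftMul_pt_zero V v)
  let m : V.left.presheaf.stalk (0 : Points V).pt ⟶ .of (Jets V M) := CommRingCat.ofHom
    (Ideal.Quotient.mk (IsLocalRing.maximalIdeal (localRing V 0) ^ M))
  have h4 : (jetInclusion V M ≫ leftMul V v).left =
      Spec.map (Scheme.stalkEnd _ (leftMul_pt_zero V v) ≫ m) ≫ V.left.fromSpecStalk _ := by
    rw [Spec.map_comp, Category.assoc, h3, ← Category.assoc]; rfl
  have h5 : (jetInclusion V M).left = Spec.map m ≫ V.left.fromSpecStalk _ := rfl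
  constructor
  · intro h
    have h6 := h4.symm.trans (congr($(h).left).trans h5)
    have h7 := Scheme.specMap_fromSpecStalk_cancel h6
    ext y
    obtain ⟨f, rfl⟩ := Ideal.Quotient.mk_surjective y
    exact congr($(h7).hom f)
  · intro h
    ext1
    rw [h4, h5]
    congr 2
    ext f
    exact congr($h (Ideal.Quotient.mk _ f))

lemma leftMulJets_eq_id_iff (M : ℕ) (v : Points V) :
    leftMulJets V M v = AlgHom.id K _ ↔
      ∀ f, leftMulStalk V v f - f ∈ IsLocalRing.maximalIdeal (localRing V 0) ^ M := by
  constructor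
  · intro h f
    rw [← Ideal.Quotient.eq, ← leftMulJets_mk, h]; rfl
  · intro h
    ext y
    obtain ⟨f, rfl⟩ := Ideal.Quotient.mk_surjective y
    exact Ideal.Quotient.eq.2 (h f)

/-- A point acting trivially on the full local ring at `0` is `1`; it need not be assumed a unit. -/
lemma eq_one_of_leftMulStalk_eq_id [IsAlgebraicVariety V] [IrreducibleSpace V.left] {v : Points V}
    (h : leftMulStalk V v = AlgHom.id K _) : v = 1 := by
  have := IsAlgebraicVariety.isReduced (V := V)
  have := IsAlgebraicVariety.isSeparated (V := V)
  have := Scheme.isDominant_fromSpecStalk (x := (0 : Points V).pt)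
  have h1 : Scheme.stalkEnd _ (leftMul_pt_zero V v) = 𝟙 _ := by
    ext f
    exact congr($h f)
  have h2 := Scheme.specMap_stalkEnd_fromSpecStalk _ (leftMul_pt_zero V v)
  rw [h1, Spec.map_id, Category.id_comp] at h2
  have h3 : (leftMul V v).left = 𝟙 V.left :=
    ext_of_isDominant_of_isSeparated V.hom (by rw [Over.w, Category.id_comp])
      (V.left.fromSpecStalk (0 : Points V).pt) (by rw [← h2, Category.comp_id])
  apply leftMul_injective V
  rw [leftMul_one]
  ext1
  exact h3

lemma isClosed_setOf_leftMulStalk_sub_mem [IsSeparated V.hom] (M : ℕ) :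
    @IsClosed _ (zariskiTopology V) {v : Points V |
      ∀ f, leftMulStalk V v f - f ∈ IsLocalRing.maximalIdeal (localRing V 0) ^ M} := by
  simpa only [jetInclusion_comp_leftMul_eq_iff, leftMulJets_eq_id_iff] using
    isClosed_setOf_comp_leftMul_eq V (jetInclusion V M)

/-- A point that acts trivially on `A / I ^ N`, for a fixed large `N`, acts trivially on `A`. -/
lemma exists_forall_leftMulStalk_eq_id [IsAlgebraicVariety V] :
    ∃ N : ℕ, ∀ v : Points V,
      (∀ f, leftMulStalk V v f - f ∈ IsLocalRing.maximalIdeal (localRing V 0) ^ N) →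
        leftMulStalk V v = AlgHom.id K _ := by
  have := IsAlgebraicVariety.isSeparated (V := V)
  have := isNoetherian_left V
  let _ := zariskiTopology V
  have : TopologicalSpace.NoetherianSpace (Points V) :=
    Topology.IsInducing.noetherianSpace (i := Points.pt) ⟨rfl⟩
  let C (M : ℕ) : TopologicalSpace.Closeds (Points V) :=
    ⟨_, isClosed_setOf_leftMulStalk_sub_mem V M⟩
  have hC : Antitone C := fun M N hMN v hv f ↦ Ideal.pow_le_pow_right hMN (hv f)
  obtain ⟨N, hN⟩ := WellFoundedLT.antitone_chain_condition (f := C) hC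
  refine ⟨N, fun v hv ↦ ?_⟩
  have h (M : ℕ) : v ∈ C M := by
    rcases le_total M N with hM | hM
    · exact hC hM hv
    · rw [← hN M hM]; exact hv
  ext f
  have h0 := (Submodule.mem_iInf _).2 fun M ↦ h M f
  rw [Ideal.iInf_pow_eq_bot_of_isLocalRing _ (Ideal.IsPrime.ne_top inferInstance)] at h0
  exact sub_eq_zero.1 h0

end Jets
end RingObject
end RingVariety

/-! ### Linearity of the group of units -/

lemma isLinearGroup_of_injective {K G B : Type*} [Field K] [Group G] [Ring B] [Algebra K B]
    [Module.Finite K B] (ψ : G →* (B ≃ₐ[K] B)) (hψ : Function.Injective ψ) : IsLinearGroup K G := by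
  let b := Module.finBasis K B
  let e : LinearMap.GeneralLinearGroup K B ≃* GL (Fin (Module.finrank K B)) K :=
    Units.mapEquiv (LinearMap.toMatrixAlgEquiv b).toMulEquiv
  let c := (LinearMap.GeneralLinearGroup.generalLinearEquiv K B).symm
  let l : (B ≃ₐ[K] B) →* (B ≃ₗ[K] B) :=
    { toFun := fun f ↦ f.toLinearEquiv, map_one' := rfl, map_mul' := fun _ _ ↦ rfl }
  refine ⟨_, e.toMonoidHom.comp (c.toMonoidHom.comp (l.comp ψ)), ?_⟩
  exact e.injective.comp (c.injective.comp
    (AlgEquiv.toLinearEquiv_injective.comp hψ))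

theorem lemma7 {K : Type u} [Field K] (V : Over (Spec (.of K)))
    [RingVariety.IsAlgebraicVariety V] [RingObj V] [IrreducibleSpace V.left] :
    IsLinearGroup K (RingVariety.Points V)ˣ ∧
      ∃ M : ℕ, 0 < M ∧ Module.Finite K (RingVariety.Jets V M) ∧
        ∃ ψ : (RingVariety.Points V)ˣ →* (RingVariety.Jets V M ≃ₐ[K] RingVariety.Jets V M),
          RingVariety.IsJetAction V M ψ ∧ Function.Injective ψ := by
  have := RingVariety.isNoetherian_left V
  obtain ⟨N, hN⟩ := RingVariety.exists_forall_leftMulStalk_eq_id V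
  have hfin := RingVariety.finite_localRing_quotient (0 : RingVariety.Points V) N.succ_pos
  -- `A / I ^ N` is replaced by `A / I ^ (N + 1)`, as `N` may be `0`.
  have hinj : Function.Injective (RingVariety.jetAction V (N + 1)) := by
    refine (injective_iff_map_eq_one _).2 fun v hv ↦ ?_
    rw [← inv_eq_one, ← Units.val_eq_one]
    refine RingVariety.eq_one_of_leftMulStalk_eq_id V (hN _ fun f ↦ ?_)
    refine Ideal.pow_le_pow_right N.le_succ
      ((RingVariety.leftMulJets_eq_id_iff V (N + 1) ↑v⁻¹).1 ?_ f)
    ext y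
    exact congr($hv y)
  exact ⟨isLinearGroup_of_injective _ hinj, N + 1, N.succ_pos, hfin, _,
    RingVariety.isJetAction_jetAction V _, hinj⟩
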